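/- Let $N$ be a lattice (a free abelian group of finite rank), $M=\mathrm{Hom}(N,\mathbb{Z})$ its dual, and $\Sigma$ a fan in $N_{\mathbb{R}}=N\otimes\mathbb{R}$: a finite nonempty collection of strongly convex rational polyhedral cones which is closed under passing to faces and in which any two cones meet in a common face. Let $Y=X_\Sigma$ be the associated complex toric variety (possibly singular, not necessarily compact), with torus $T=\mathrm{Hom}(M,\mathbb{C}^\times)\subset Y$, and for each ray $\rho$ of $\Sigma$ let $v_\rho\in N$ be its primitive generator and $D_\rho\subset Y$ the corresponding toric divisor, i.e. the closure of the torus orbit $O(\rho)$. (1) Suppose that some $\nu\in M$ defines a holomorphic function on $Y$ whose zeros contain all toric divisors of $Y$, i.e. the character $\chi^\nu$ of $T$ extends to a holomorphic function $f$ on $Y$ with $f=0$ on $D_\rho$ for every ray $\rho$. Then every non-constant holomorphic map $u:\mathbf{P}^1\to Y$ has image contained in the union $\bigcup_\rho D_\rho$ of the toric divisors. (2) Suppose that $Y$ is a toric Calabi-Yau variety, i.e. there is $\nu\in M$ with $(\nu,v_\rho)=1$ for all rays $\rho$ of $\Sigma$. Then a character as in (1) exists, and hence every non-constant holomorphic map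 $u:\mathbf{P}^1\to Y$ has image contained in $\bigcup_\rho D_\rho$. -/

import Mathlib

open scoped TensorProduct Topology

noncomputable section

namespace ToricGeometry

/-! ### Lattices and fans

`N` is a lattice (a free `ℤ`-module of finite rank), `M = Module.Dual ℤ N` is its dual lattice and
`ℝ ⊗[ℤ] N` is the real vector space `N_ℝ`. -/

/-- The real vector space `N_ℝ = ℝ ⊗ N`. -/
abbrev RealSpace (N : Type*) [AddCommGroup N] : Type _ := ℝ ⊗[ℤ] N

/-- The pairing of `m ∈ M` with vectors of `N_ℝ`, i.e. the real-linear extension of `m`. -/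
def pairing {N : Type*} [AddCommGroup N] (m : Module.Dual ℤ N) : RealSpace N →ₗ[ℝ] ℝ :=
  Module.Dual.baseChange ℝ m

@[simp] theorem pairing_tmul {N : Type*} [AddCommGroup N] (m : Module.Dual ℤ N) (r : ℝ) (v : N) :
    pairing m (r ⊗ₜ[ℤ] v) = r * (m v : ℝ) := by
  simp [pairing, mul_comm, Module.Dual.baseChange_apply_tmul]

@[simp] theorem pairing_zero {N : Type*} [AddCommGroup N] :
    pairing (0 : Module.Dual ℤ N) = 0 := by
  simp [pairing]

theorem pairing_add {N : Type*} [AddCommGroup N] (m m' : Module.Dual ℤ N) :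
    pairing (m + m') = pairing m + pairing m' := by
  simp [pairing]

/-- The rational polyhedral cone in `N_ℝ` generated by a set of lattice vectors. -/
def latticeCone {N : Type*} [AddCommGroup N] (s : Set N) : PointedCone ℝ (RealSpace N) :=
  PointedCone.hull ℝ ((fun v : N => (1 : ℝ) ⊗ₜ[ℤ] v) '' s)

/-- A fan in `N_ℝ`: a finite nonempty collection of strongly convex rational polyhedral cones,
closed under passing to faces, and such that any two of them meet in a common face. -/
structure Fan (N : Type*) [AddCommGroup N] where
  /-- the cones of the fan -/
  cones : Set (PointedCone ℝ (RealSpace N))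
  finite : cones.Finite
  zero_mem : ⊥ ∈ cones
  rational : ∀ σ ∈ cones, ∃ s : Finset N, σ = latticeCone (s : Set N)
  salient : ∀ σ ∈ cones, σ.toConvexCone.Salient
  face_mem : ∀ σ ∈ cones, ∀ τ : PointedCone ℝ (RealSpace N), τ.IsFaceOf σ → τ ∈ cones
  inter_face : ∀ σ ∈ cones, ∀ τ ∈ cones, (σ ⊓ τ).IsFaceOf σ

/-- A lattice vector is primitive if it is nonzero and not a proper integral multiple of another
lattice vector. -/
def IsPrimitiveVector {N : Type*} [AddCommGroup N] (v : N) : Prop :=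
  v ≠ 0 ∧ ∀ (k : ℤ) (w : N), v = k • w → IsUnit k

/-! ### Affine toric varieties -/

/-- The monoid `S_σ = σ^∨ ∩ M`. -/
def dualMonoid {N : Type*} [AddCommGroup N] (σ : PointedCone ℝ (RealSpace N)) :
    AddSubmonoid (Module.Dual ℤ N) where
  carrier := {m | ∀ x ∈ σ, 0 ≤ pairing m x}
  zero_mem' := by
    intro x _
    simp
  add_mem' := by
    intro a b ha hb x hx
    rw [pairing_add]
    exact add_nonneg (ha x hx) (hb x hx)

theorem dualMonoid_anti {N : Type*} [AddCommGroup N] {τ σ : PointedCone ℝ (RealSpace N)}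
    (h : τ ≤ σ) : dualMonoid σ ≤ dualMonoid τ :=
  fun _ hm x hx => hm x (h hx)

/-- The affine toric variety `U_σ`, as the set of its complex points: monoid homomorphisms from
`S_σ` to `(ℂ, ·)`. The value of `x` at `m` is the value at `x` of the character `χ^m`. It carries
the topology of pointwise convergence; since `S_σ` is finitely generated, this is the classical
topology of the affine variety `U_σ`. -/
def AffineChart {N : Type*} [AddCommGroup N] (σ : PointedCone ℝ (RealSpace N)) : Type _ :=
  {x : dualMonoid σ → ℂ // x 0 = 1 ∧ ∀ a b, x (a + b) = x a * x b}

instance {N : Type*} [AddCommGroup N] (σ : PointedCone ℝ (RealSpace N)) :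
    TopologicalSpace (AffineChart σ) :=
  instTopologicalSpaceSubtype

/-- The map `U_τ → U_σ` for `τ ⊆ σ`, restricting a homomorphism on `S_τ` to `S_σ ⊆ S_τ`. -/
def AffineChart.restrict {N : Type*} [AddCommGroup N] {τ σ : PointedCone ℝ (RealSpace N)}
    (h : τ ≤ σ) (x : AffineChart τ) : AffineChart σ :=
  ⟨fun m => x.1 ⟨m.1, dualMonoid_anti h m.2⟩, x.2.1, fun a b =>
    x.2.2 ⟨a.1, dualMonoid_anti h a.2⟩ ⟨b.1, dualMonoid_anti h b.2⟩⟩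

/-- The algebraic torus `T = Hom(M, ℂ^×)`. The character `χ^m` of `T` is `t ↦ t m`. -/
abbrev Torus (N : Type*) [AddCommGroup N] : Type _ :=
  Multiplicative (Module.Dual ℤ N) →* ℂˣ

/-- A point of the torus gives a point of each affine chart. -/
def Torus.toChart {N : Type*} [AddCommGroup N] (σ : PointedCone ℝ (RealSpace N)) (t : Torus N) :
    AffineChart σ :=
  ⟨fun m => (t (Multiplicative.ofAdd m.1) : ℂ), by simp, fun a b => by simp [ofAdd_add]⟩

/-! ### The toric variety of a fan -/

namespace Fan

variable {N : Type*} [AddCommGroup N] (F : Fan N)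

/-- The gluing relation: for cones `τ ⊆ σ` of the fan (so that `τ` is a face of `σ`), a point of
`U_τ` is identified with its image in `U_σ`. -/
def Glue (p q : Σ σ : F.cones, AffineChart σ.1) : Prop :=
  ∃ h : q.1.1 ≤ p.1.1, p.2 = q.2.restrict h

/-- The toric variety `X_Σ` of the fan (its complex points): the affine charts `U_σ`, glued along
the inclusions `U_τ → U_σ` for `τ` a face of `σ`. -/
def Variety : Type _ := Quot F.Glue

/-- The classical (complex) topology of the toric variety. -/
instance : TopologicalSpace F.Variety :=
  inferInstanceAs (TopologicalSpace (Quot F.Glue))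

/-- The inclusion `U_σ → X_Σ`. -/
def incl (σ : F.cones) (x : AffineChart σ.1) : F.Variety := Quot.mk _ ⟨σ, x⟩

/-- The inclusion of the torus `T = U_{0}` in `X_Σ`. -/
def torusIncl (t : Torus N) : F.Variety := F.incl ⟨⊥, F.zero_mem⟩ (t.toChart ⊥)

/-- The torus orbit `O(σ)`: the points of `U_σ` at which `χ^m`, `m ∈ S_σ`, is nonzero exactly when
`m ∈ σ^⊥`. -/
def orbit (σ : F.cones) : Set F.Variety :=
  F.incl σ '' {x | ∀ m : dualMonoid σ.1, x.1 m ≠ 0 ↔ ∀ y ∈ σ.1, pairing m.1 y = 0}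

/-- The rays of the fan, given through their primitive generators. -/
def Ray : Type _ := {v : N // IsPrimitiveVector v ∧ latticeCone {v} ∈ F.cones}

/-- The primitive generator of a ray. -/
def Ray.gen {F : Fan N} (ρ : F.Ray) : N := ρ.1

/-- The one-dimensional cone spanned by a ray. -/
def Ray.cone {F : Fan N} (ρ : F.Ray) : F.cones := ⟨latticeCone {ρ.1}, ρ.2.2⟩

/-- The toric divisor `D_ρ` of a ray: the closure of the orbit `O(ρ)`. -/
def toricDivisor (ρ : F.Ray) : Set F.Variety := closure (F.orbit ρ.cone)

/-! ### Holomorphic functions and maps -/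

/-- `f` is holomorphic at `p`, for the structure of a (possibly singular) reduced complex space on
`X_Σ`: near `p`, in an affine chart, `f` is a holomorphic function of finitely many of the
coordinates `χ^m`. -/
def IsHolomorphicAt (f : F.Variety → ℂ) (p : F.Variety) : Prop :=
  ∃ (σ : F.cones) (x : AffineChart σ.1) (k : ℕ) (m : Fin k → dualMonoid σ.1)
    (g : (Fin k → ℂ) → ℂ),
    F.incl σ x = p ∧ AnalyticAt ℂ g (fun i => x.1 (m i)) ∧
      ∀ᶠ y in 𝓝 x, f (F.incl σ y) = g (fun i => y.1 (m i))

/-- `f` is a holomorphic function on `X_Σ`. -/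
def IsHolomorphic (f : F.Variety → ℂ) : Prop := ∀ p, F.IsHolomorphicAt f p

end Fan

/-- The chart `w = 1 / z` of the Riemann sphere `P^1 = ℂ ∪ {∞}` around `∞`. -/
def sphereChartInfty (w : ℂ) : OnePoint ℂ :=
  open Classical in if w = 0 then OnePoint.infty else ((w⁻¹ : ℂ) : OnePoint ℂ)

/-- A function on the Riemann sphere `P^1 = ℂ ∪ {∞}` is holomorphic at a point: it is so in the
coordinate `z` at the points of `ℂ`, and in the coordinate `w = 1 / z` at `∞`. -/
def SphereHolomorphicAt (h : OnePoint ℂ → ℂ) (p : OnePoint ℂ) : Prop :=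
  (∀ z : ℂ, p = (z : OnePoint ℂ) → AnalyticAt ℂ (fun z' : ℂ => h (z' : OnePoint ℂ)) z) ∧
    (p = OnePoint.infty → AnalyticAt ℂ (fun w : ℂ => h (sphereChartInfty w)) 0)

namespace Fan

variable {N : Type*} [AddCommGroup N] (F : Fan N)

/-- A map `u : P^1 → X_Σ` is holomorphic: it is continuous and pulls back germs of holomorphic
functions to germs of holomorphic functions (a morphism of reduced complex spaces). -/
def IsHolomorphicSphere (u : OnePoint ℂ → F.Variety) : Prop :=
  Continuous u ∧ ∀ (p : OnePoint ℂ) (f : F.Variety → ℂ),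
    F.IsHolomorphicAt f (u p) → SphereHolomorphicAt (f ∘ u) p

/-- The character `ν ∈ M` defines a holomorphic function on `X_Σ` whose zeros contain all toric
divisors: the function `χ^ν` on the torus extends to such a function. -/
def DefinesVanishingFunction (ν : Module.Dual ℤ N) : Prop :=
  ∃ f : F.Variety → ℂ, F.IsHolomorphic f ∧
    (∀ t : Torus N, f (F.torusIncl t) = (t (Multiplicative.ofAdd ν) : ℂ)) ∧
    ∀ ρ : F.Ray, ∀ p ∈ F.toricDivisor ρ, f p = 0

/-- The Calabi-Yau condition: some `ν ∈ M` pairs to `1` with the primitive generators of all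
rays. -/
def IsCalabiYau : Prop := ∃ ν : Module.Dual ℤ N, ∀ ρ : F.Ray, ν ρ.gen = 1

/-- Every nonconstant holomorphic map `P^1 → X_Σ` has image in the union of the toric divisors. -/
def SpheresLieInDivisors : Prop :=
  ∀ u : OnePoint ℂ → F.Variety, F.IsHolomorphicSphere u → (¬ ∃ c, ∀ p, u p = c) →
    Set.range u ⊆ ⋃ ρ : F.Ray, F.toricDivisor ρ

end Fan

end ToricGeometry

end

open scoped TensorProduct Topology

noncomputable section

namespace ToricGeometry

/-! ### Rational polyhedral cones -/

/-! A holomorphic function on `P^1` is constant (`eq_of_sphereHolomorphicAt`), so `f ∘ u` is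
constant for the given `f`. Every point of `X_Σ` lies in the torus or on some `D_ρ`
(`mem_torus_or_mem_toricDivisor`). On the torus `f = χ^ν` is nonzero, while `f = 0` on each `D_ρ`.
Hence if `u` meets the torus, it avoids every divisor and stays in the torus; there all characters
are constant along `u`, and they separate torus points, so `u` is constant.

In the Calabi-Yau case `ν` is nonnegative on every cone, because cones are generated by rays of the
fan (`exists_ray_generators`). So `χ^ν` is a coordinate on every chart, and it vanishes on each
`O(ρ)` because `ν` is not in `ρ^⊥`; continuity gives the closure.

The two substantial inputs are convex geometry (extremal generators span faces) and the fact that a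
boundary point is a limit of points of some `O(ρ)` (`exists_mem_toricDivisor`). -/

/-- The nonzero vectors of a salient cone form a convex set. -/
theorem convex_nonzero_of_salient {V : Type*} [AddCommGroup V] [Module ℝ V]
    {σ : PointedCone ℝ V} (hσ : σ.toConvexCone.Salient) : Convex ℝ {x | x ∈ σ ∧ x ≠ 0} := by
  rintro x ⟨hx, hx0⟩ y ⟨hy, hy0⟩ a b ha hb hab
  have hax : a • x ∈ σ := σ.smul_mem ha hx
  have hby : b • y ∈ σ := σ.smul_mem hb hy
  refine ⟨σ.add_mem hax hby, fun h => ?_⟩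
  rcases eq_or_ne a 0 with rfl | ha0
  · obtain rfl : b = 1 := by linarith
    simp [hy0] at h
  · refine hσ (a • x) hax (smul_ne_zero ha0 hx0) ?_
    rw [neg_eq_of_add_eq_zero_right h]
    exact hby

/-- Finitely many nonzero vectors of a salient cone lie in an open half space. -/
theorem exists_pos_real_functional {V : Type*} [AddCommGroup V] [Module ℝ V]
    [FiniteDimensional ℝ V] {σ : PointedCone ℝ V} (hσ : σ.toConvexCone.Salient)
    {s : Set V} (hs : s.Finite) (hsσ : ∀ v ∈ s, v ∈ σ) (hs0 : ∀ v ∈ s, v ≠ 0) :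
    ∃ φ : V →ₗ[ℝ] ℝ, ∀ v ∈ s, 0 < φ v := by
  -- `V` carries no topology, so the separation of `0` from the convex hull is done in coordinates.
  let e := (Module.finBasis ℝ V).equivFun
  have h0 : (0 : Fin (Module.finrank ℝ V) → ℝ) ∉ convexHull ℝ (e '' s) := by
    rw [show (e '' s : Set _) = (e : V →ₗ[ℝ] _) '' s from rfl, ← LinearMap.image_convexHull]
    rintro ⟨x, hx, hx0⟩
    have := convexHull_min (t := {x | x ∈ σ ∧ x ≠ 0})
      (fun v hv => ⟨hsσ v hv, hs0 v hv⟩) (convex_nonzero_of_salient hσ) hx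
    exact this.2 (e.map_eq_zero_iff.mp hx0)
  obtain ⟨f, u, hu, hf⟩ := geometric_hahn_banach_point_closed (convex_convexHull ℝ _)
    ((hs.image e).isClosed_convexHull ℝ) h0
  refine ⟨f.toLinearMap ∘ₗ e.toLinearMap, fun v hv => ?_⟩
  have := hf (e v) (subset_convexHull ℝ _ ⟨v, hv, rfl⟩)
  simp only [map_zero] at hu
  exact hu.trans this

/-! ### Lattice functionals, primitive generators and rays -/

section Lattice

variable {N : Type*} [AddCommGroup N]

theorem tmul_mem_latticeCone {s : Set N} {v : N} (hv : v ∈ s) :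
    (1 : ℝ) ⊗ₜ[ℤ] v ∈ latticeCone s :=
  PointedCone.subset_hull ⟨v, hv, rfl⟩

theorem mem_latticeCone {s : Finset N} {x : RealSpace N} :
    x ∈ latticeCone (s : Set N) ↔
      ∃ c : N → ℝ, (∀ v, 0 ≤ c v) ∧ ∑ v ∈ s, c v • ((1 : ℝ) ⊗ₜ[ℤ] v) = x := by
  constructor
  · intro hx
    obtain ⟨l, -, rfl⟩ := (Submodule.mem_span_image_finset_iff_exists_fun' _).mp hx
    exact ⟨fun v => (l v : ℝ), fun v => (l v).2, rfl⟩
  · rintro ⟨c, hc, rfl⟩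
    exact Submodule.sum_mem _ fun v hv =>
      Submodule.smul_mem _ (⟨c v, hc v⟩ : {r : ℝ // 0 ≤ r}) (tmul_mem_latticeCone hv)

theorem mem_latticeCone_singleton {v : N} {x : RealSpace N} :
    x ∈ latticeCone {v} ↔ ∃ c : ℝ, 0 ≤ c ∧ c • ((1 : ℝ) ⊗ₜ[ℤ] v) = x := by
  have := mem_latticeCone (s := {v}) (x := x)
  rw [Finset.coe_singleton] at this
  rw [this]
  constructor
  · rintro ⟨c, hc, h⟩
    exact ⟨c v, hc v, by simpa using h⟩
  · rintro ⟨c, hc, h⟩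
    exact ⟨fun _ => c, fun _ => hc, by simpa using h⟩

theorem latticeCone_mono {s t : Set N} (h : s ⊆ t) : latticeCone s ≤ latticeCone t :=
  Submodule.span_mono (Set.image_mono h)

theorem mem_dualMonoid_latticeCone {s : Set N} {m : Module.Dual ℤ N} :
    m ∈ dualMonoid (latticeCone s) ↔ ∀ v ∈ s, 0 ≤ m v := by
  constructor
  · intro h v hv
    simpa using h _ (tmul_mem_latticeCone hv)
  · intro h x hx
    induction hx using Submodule.span_induction with
    | mem x hx =>
      obtain ⟨v, hv, rfl⟩ := hx
      simpa using h v hv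
    | zero => simp
    | add x y _ _ hx hy => rw [map_add]; exact add_nonneg hx hy
    | smul a x _ hx =>
      rw [show a • x = (a : ℝ) • x from rfl, map_smul]
      exact mul_nonneg a.2 hx

theorem pairing_eq_zero_on_ray {v : N} {m : Module.Dual ℤ N} :
    (∀ y ∈ latticeCone {v}, pairing m y = 0) ↔ m v = 0 := by
  constructor
  · intro h
    simpa using h _ (tmul_mem_latticeCone (Set.mem_singleton v))
  · intro h y hy
    obtain ⟨c, -, rfl⟩ := mem_latticeCone_singleton.mp hy
    simp [h]

variable [Module.Free ℤ N]

theorem one_tmul_ne_zero {v : N} (hv : v ≠ 0) : (1 : ℝ) ⊗ₜ[ℤ] v ≠ 0 := by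
  intro h
  apply hv
  refine (Module.Free.chooseBasis ℤ N).ext_elem fun i => ?_
  have := congrArg (pairing ((Module.Free.chooseBasis ℤ N).coord i)) h
  simpa using this

variable [Module.Finite ℤ N]

/-- A positive real functional on finitely many lattice vectors can be replaced by an integral
one. -/
theorem exists_pos_dual_of_real {s : Set N} (hs : s.Finite) (φ : RealSpace N →ₗ[ℝ] ℝ)
    (hφ : ∀ v ∈ s, 0 < φ ((1 : ℝ) ⊗ₜ[ℤ] v)) : ∃ m : Module.Dual ℤ N, ∀ v ∈ s, 0 < m v := by
  let b := Module.Free.chooseBasis ℤ N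
  -- Positivity on finitely many vectors is an open condition on the values at a basis, so it holds
  -- at some rational point; clearing denominators makes that point integral.
  let U : Set (Module.Free.ChooseBasisIndex ℤ N → ℝ) :=
    ⋂ v ∈ s, {r | 0 < ∑ i, (b.repr v i : ℝ) * r i}
  have hU : IsOpen U := hs.isOpen_biInter fun v _ =>
    isOpen_lt continuous_const (by fun_prop)
  have hUn : U.Nonempty := by
    refine ⟨fun i => φ ((1 : ℝ) ⊗ₜ[ℤ] b i), Set.mem_iInter₂.mpr fun v hv => ?_⟩
    have h := hφ v hv
    rw [← b.sum_repr v, TensorProduct.tmul_sum, map_sum] at h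
    simp only [TensorProduct.tmul_smul, map_zsmul, zsmul_eq_mul] at h
    exact h
  obtain ⟨q, hq⟩ := (DenseRange.piMap (f := fun _ => ((↑) : ℚ → ℝ))
    (fun _ : Module.Free.ChooseBasisIndex ℤ N => Rat.denseRange_cast)).exists_mem_open hU hUn
  let d : ℕ := ∏ i, (q i).den
  have hd : 0 < d := Finset.prod_pos fun i _ => (q i).pos
  have hz : ∀ i, ∃ z : ℤ, (z : ℝ) = d * (q i : ℝ) := by
    intro i
    obtain ⟨k, hk⟩ : (q i).den ∣ d := Finset.dvd_prod_of_mem _ (Finset.mem_univ i)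
    refine ⟨k * (q i).num, ?_⟩
    have h := Rat.den_mul_eq_num (q i)
    have h' : ((q i).den : ℝ) * (q i : ℝ) = (q i).num := by exact_mod_cast h
    rw [hk]
    push_cast
    rw [← h']
    ring
  choose z hz using hz
  refine ⟨b.constr ℤ z, fun v hv => ?_⟩
  have h : 0 < ∑ i, (b.repr v i : ℝ) * (q i : ℝ) := by
    simpa using Set.mem_iInter₂.mp hq v hv
  have : (0 : ℝ) < ((b.constr ℤ z v : ℤ) : ℝ) := by
    rw [Module.Basis.constr_apply_fintype]
    push_cast
    have e : ∑ i, ((b.equivFun v i • z i : ℤ) : ℝ) =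
        d * ∑ i, (b.repr v i : ℝ) * (q i : ℝ) := by
      rw [Finset.mul_sum]
      refine Finset.sum_congr rfl fun i _ => ?_
      rw [smul_eq_mul, Int.cast_mul, hz i]
      simp only [Module.Basis.equivFun_apply]
      ring
    rw [e]
    positivity
  exact_mod_cast this

/-- A salient rational cone has a lattice functional which is positive on its nonzero
generators. -/
theorem exists_pos_dual {s : Set N} (hs : s.Finite)
    (h : (latticeCone s).toConvexCone.Salient) :
    ∃ m : Module.Dual ℤ N, ∀ v ∈ s, v ≠ 0 → 0 < m v := by
  obtain ⟨φ, hφ⟩ := exists_pos_real_functional h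
    (s := (fun v : N => (1 : ℝ) ⊗ₜ[ℤ] v) '' (s ∩ {v | v ≠ 0}))
    ((hs.inter_of_left _).image _)
    (by rintro _ ⟨v, hv, rfl⟩; exact tmul_mem_latticeCone hv.1)
    (by rintro _ ⟨v, hv, rfl⟩; exact one_tmul_ne_zero hv.2)
  obtain ⟨m, hm⟩ := exists_pos_dual_of_real (hs.inter_of_left {v | v ≠ 0}) φ
    fun v hv => hφ _ ⟨v, hv, rfl⟩
  exact ⟨m, fun v hv hv0 => hm v ⟨hv, hv0⟩⟩

/-- The monoid `S_σ` of a salient rational cone generates `M`. -/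
theorem exists_sub_of_salient {s : Set N} (hs : s.Finite)
    (h : (latticeCone s).toConvexCone.Salient) (m : Module.Dual ℤ N) :
    ∃ b ∈ dualMonoid (latticeCone s), m + b ∈ dualMonoid (latticeCone s) := by
  obtain ⟨m₀, hm₀⟩ := exists_pos_dual hs h
  have hm₀' : ∀ v ∈ s, 0 ≤ m₀ v := fun v hv => by
    rcases eq_or_ne v 0 with rfl | hv0
    · simp
    · exact (hm₀ v hv hv0).le
  have hk : ∃ k : ℕ, ∀ v ∈ s, |m v| ≤ k := by
    obtain ⟨K, hK⟩ := (hs.image fun v => |m v|).bddAbove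
    exact ⟨K.toNat, fun v hv => (hK ⟨v, hv, rfl⟩).trans (Int.self_le_toNat K)⟩
  obtain ⟨k, hk⟩ := hk
  -- On each nonzero generator `m₀ ≥ 1`, so `k • m₀` outweighs `m` there.
  refine ⟨k • m₀, AddSubmonoid.nsmul_mem _ (mem_dualMonoid_latticeCone.mpr hm₀') k,
    mem_dualMonoid_latticeCone.mpr fun v hv => ?_⟩
  rcases eq_or_ne v 0 with rfl | hv0
  · simp
  · have h1 := hm₀ v hv hv0
    have h2 := hk v hv
    have h3 := neg_abs_le (m v)
    simp only [LinearMap.add_apply, LinearMap.smul_apply, nsmul_eq_mul]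
    nlinarith

omit [Module.Free ℤ N] [Module.Finite ℤ N] in
/-- A lattice vector on which some functional is positive is a positive multiple of a primitive
one. -/
theorem exists_primitive {m : Module.Dual ℤ N} {v : N} (hv : 0 < m v) :
    ∃ w : N, IsPrimitiveVector w ∧ latticeCone {w} = latticeCone {v} := by
  -- Among the vectors of which `v` is a positive multiple, one with the least value of `m` is
  -- primitive: dividing it by `j > 1` would lower that value.
  let P : ℕ → Prop := fun n => ∃ w : N, m w = n ∧ ∃ k : ℕ, 0 < k ∧ v = k • w
  have hP : ∃ n, P n := ⟨(m v).toNat, v, (Int.toNat_of_nonneg hv.le).symm, 1, one_pos, by simp⟩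
  classical
  obtain ⟨w, hw, k, hk, hvk⟩ := Nat.find_spec hP
  have hmv : m v = k * m w := by rw [hvk]; simp
  have hw0 : 0 < m w := by
    rw [hmv] at hv
    exact pos_of_mul_pos_right hv (by positivity)
  have key : ∀ (j : ℤ) (w' : N), 0 < j → w = j • w' → j = 1 := by
    intro j w' hj hw'
    have e : m w = j * m w' := by rw [hw']; simp
    have hw'0 : 0 < m w' := by
      rw [e] at hw0
      exact pos_of_mul_pos_right hw0 hj.le
    have : Nat.find hP ≤ (m w').toNat := by
      refine Nat.find_min' hP ⟨w', (Int.toNat_of_nonneg hw'0.le).symm, k * j.toNat,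
        Nat.mul_pos hk (by omega), ?_⟩
      rw [hvk, hw', mul_smul, ← natCast_zsmul w' j.toNat, Int.toNat_of_nonneg hj.le]
    have h1 : m w ≤ m w' := by omega
    nlinarith
  refine ⟨w, ⟨fun h => by simp [h] at hw0, fun j w' hw' => ?_⟩, ?_⟩
  · rcases lt_trichotomy j 0 with hj | rfl | hj
    · have := key (-j) (-w') (by omega) (by simpa using hw')
      exact Int.isUnit_iff.mpr (Or.inr (by omega))
    · simp [hw'] at hw0
    · exact Int.isUnit_iff.mpr (Or.inl (key j w' hj hw'))
  · have e : (1 : ℝ) ⊗ₜ[ℤ] v = (k : ℝ) • ((1 : ℝ) ⊗ₜ[ℤ] w) := by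
      rw [hvk, TensorProduct.tmul_smul, Nat.cast_smul_eq_nsmul]
    ext x
    rw [mem_latticeCone_singleton, mem_latticeCone_singleton]
    constructor
    · rintro ⟨c, hc, rfl⟩
      refine ⟨c / k, by positivity, ?_⟩
      rw [e, smul_smul, div_mul_cancel₀ _ (by positivity)]
    · rintro ⟨c, hc, rfl⟩
      exact ⟨c * k, by positivity, by rw [e, smul_smul]⟩

/-- A member of a minimal generating set of a salient rational cone spans a face. -/
theorem isFaceOf_of_minimal [DecidableEq N] {s : Finset N}
    (h : (latticeCone (s : Set N)).toConvexCone.Salient) {v : N} (hv : v ∈ s)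
    (hmin : (1 : ℝ) ⊗ₜ[ℤ] v ∉ latticeCone (s.erase v : Finset N)) :
    (latticeCone {v}).IsFaceOf (latticeCone (s : Set N)) := by
  obtain ⟨m, hm⟩ := exists_pos_dual s.finite_toSet h
  refine ⟨latticeCone_mono (by simpa using hv), fun {x y a} hx hy ha hxy => ?_⟩
  obtain ⟨c, hc, rfl⟩ := mem_latticeCone.mp hx
  obtain ⟨d, hd, rfl⟩ := mem_latticeCone.mp hy
  obtain ⟨r, hr, hxy⟩ := mem_latticeCone_singleton.mp hxy
  -- All multiples of `v` in `a • x + y = r • v` go to the right. Were the coefficient there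
  -- positive, `v` would be redundant. So it is nonpositive, and applying `m` makes every term on
  -- the left vanish, leaving `x` a multiple of `v`.
  have e : ∑ w ∈ s.erase v, (a * c w + d w) • ((1 : ℝ) ⊗ₜ[ℤ] w) =
      (r - (a * c v + d v)) • ((1 : ℝ) ⊗ₜ[ℤ] v) := by
    rw [sub_smul, hxy, Finset.smul_sum, ← Finset.sum_add_distrib, eq_sub_iff_add_eq,
      Finset.sum_erase_add (a := v) (f := fun w => (a * c w + d w) • ((1 : ℝ) ⊗ₜ[ℤ] w)) s hv]
    exact Finset.sum_congr rfl fun w _ => by rw [add_smul, mul_smul]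
  have hcd : ∀ w, 0 ≤ a * c w + d w := fun w => add_nonneg (mul_nonneg ha.le (hc w)) (hd w)
  have hle : r - (a * c v + d v) ≤ 0 := by
    by_contra! hpos
    apply hmin
    have hmem : (r - (a * c v + d v)) • ((1 : ℝ) ⊗ₜ[ℤ] v) ∈
        latticeCone (s.erase v : Finset N) := by
      rw [← e]
      exact mem_latticeCone.mpr ⟨_, hcd, rfl⟩
    have := Submodule.smul_mem _ (⟨_, (inv_pos.mpr hpos).le⟩ : {r : ℝ // 0 ≤ r}) hmem
    have h1 : (r - (a * c v + d v))⁻¹ • ((r - (a * c v + d v)) • ((1 : ℝ) ⊗ₜ[ℤ] v)) ∈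
        latticeCone (s.erase v : Finset N) := this
    rwa [inv_smul_smul₀ hpos.ne'] at h1
  have hmnn : ∀ w ∈ s, (0 : ℝ) ≤ m w := fun w hw => by
    rcases eq_or_ne w 0 with rfl | hw0
    · simp
    · exact_mod_cast (hm w hw hw0).le
  have e' := congrArg (pairing m) e
  simp only [map_sum, map_smul, pairing_tmul, one_mul, smul_eq_mul] at e'
  have hterm : ∀ w ∈ s.erase v, 0 ≤ (a * c w + d w) * (m w : ℝ) := fun w hw =>
    mul_nonneg (hcd w) (hmnn w (Finset.mem_of_mem_erase hw))
  have hsum := le_antisymm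
    (e'.le.trans (mul_nonpos_of_nonpos_of_nonneg hle (hmnn v hv))) (Finset.sum_nonneg hterm)
  have hzero := (Finset.sum_eq_zero_iff_of_nonneg hterm).mp hsum
  have hc0 : ∀ w ∈ s.erase v, c w • ((1 : ℝ) ⊗ₜ[ℤ] w) = 0 := by
    intro w hw
    rcases eq_or_ne w 0 with rfl | hw0
    · simp
    have hmw : (0 : ℝ) < m w := by exact_mod_cast hm w (Finset.mem_of_mem_erase hw) hw0
    have h1 := (mul_eq_zero.mp (hzero w hw)).resolve_right hmw.ne'
    have h2 := mul_nonneg ha.le (hc w)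
    have h3 : a * c w = 0 := by linarith [hd w]
    rw [(mul_eq_zero.mp h3).resolve_left ha.ne', zero_smul]
  rw [← Finset.sum_erase_add s _ hv, Finset.sum_eq_zero hc0, zero_add]
  exact mem_latticeCone_singleton.mpr ⟨c v, hc v, rfl⟩

omit [Module.Free ℤ N] [Module.Finite ℤ N] in
/-- A rational cone has an irredundant finite set of lattice generators. -/
theorem exists_minimal_generators [DecidableEq N] (s : Finset N) :
    ∃ t : Finset N, latticeCone (t : Set N) = latticeCone (s : Set N) ∧
      ∀ v ∈ t, (1 : ℝ) ⊗ₜ[ℤ] v ∉ latticeCone (t.erase v : Finset N) := by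
  induction s using Finset.strongInduction with
  | H s ih =>
    by_cases h : ∀ v ∈ s, (1 : ℝ) ⊗ₜ[ℤ] v ∉ latticeCone (s.erase v : Finset N)
    · exact ⟨s, rfl, h⟩
    · push Not at h
      obtain ⟨v, hv, hmem⟩ := h
      obtain ⟨t, ht, hmin⟩ := ih _ (Finset.erase_ssubset hv)
      refine ⟨t, ht.trans (le_antisymm (latticeCone_mono (by simp)) ?_), hmin⟩
      refine Submodule.span_le.mpr ?_
      rintro _ ⟨w, hw, rfl⟩
      rcases eq_or_ne w v with rfl | hwv
      · simpa using hmem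
      · exact tmul_mem_latticeCone (by simpa using ⟨hw, hwv⟩)

/-- Every cone of a fan is generated by the primitive generators of finitely many rays of the
fan. -/
theorem Fan.exists_ray_generators (F : Fan N) {σ : PointedCone ℝ (RealSpace N)}
    (hσ : σ ∈ F.cones) : ∃ s : Set N, s.Finite ∧ σ = latticeCone s ∧
      ∀ v ∈ s, IsPrimitiveVector v ∧ latticeCone {v} ∈ F.cones := by
  classical
  obtain ⟨s₀, hs₀⟩ := F.rational σ hσ
  obtain ⟨s, hs, hmin⟩ := exists_minimal_generators s₀
  have hs' : σ = latticeCone (s : Set N) := hs₀.trans hs.symm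
  have hsal : (latticeCone (s : Set N)).toConvexCone.Salient := hs' ▸ F.salient σ hσ
  obtain ⟨m, hm⟩ := exists_pos_dual s.finite_toSet hsal
  have hprim : ∀ v ∈ s, ∃ w : N, IsPrimitiveVector w ∧ latticeCone {w} = latticeCone {v} := by
    intro v hv
    refine exists_primitive (hm v hv fun h0 => hmin v hv ?_)
    simp [h0]
  choose! p hp hpc using hprim
  refine ⟨p '' s, s.finite_toSet.image p, ?_, ?_⟩
  · rw [hs']
    apply le_antisymm
    · refine Submodule.span_le.mpr ?_
      rintro _ ⟨v, hv, rfl⟩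
      have h1 : (1 : ℝ) ⊗ₜ[ℤ] v ∈ latticeCone {p v} := by
        rw [hpc v hv]; exact tmul_mem_latticeCone rfl
      exact latticeCone_mono (Set.singleton_subset_iff.mpr (Set.mem_image_of_mem p hv)) h1
    · refine Submodule.span_le.mpr ?_
      rintro _ ⟨_, ⟨v, hv, rfl⟩, rfl⟩
      have h1 : (1 : ℝ) ⊗ₜ[ℤ] p v ∈ latticeCone {v} := by
        rw [← hpc v hv]; exact tmul_mem_latticeCone rfl
      exact latticeCone_mono (Set.singleton_subset_iff.mpr hv) h1
  · rintro _ ⟨v, hv, rfl⟩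
    refine ⟨hp v hv, ?_⟩
    rw [hpc v hv]
    exact F.face_mem σ hσ _ (hs' ▸ isFaceOf_of_minimal hsal hv (hmin v hv))

end Lattice

/-! ### Points of affine charts and characters of the torus -/

/-- A multiplicative nonvanishing function on a submonoid of an abelian group extends to a
character of the group, because `ℂˣ` is divisible. -/
theorem exists_character_extension {M : Type*} [AddCommGroup M] (P : AddSubmonoid M)
    (x : P → ℂ) (hx : ∀ a, x a ≠ 0) (hadd : ∀ a b, x (a + b) = x a * x b) :
    ∃ χ : Multiplicative M →* ℂˣ, ∀ a : P, (χ (Multiplicative.ofAdd a.1) : ℂ) = x a := by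
  -- `K` is the group of differences of `P`. The function extends to `K` by quotients of values,
  -- then to `M` by injectivity of the divisible group `ℂˣ`.
  let K : AddSubgroup M :=
    { carrier := {m | ∃ a b : P, m + b.1 = a.1}
      zero_mem' := ⟨0, 0, by simp⟩
      add_mem' := by
        rintro m m' ⟨a, b, h⟩ ⟨a', b', h'⟩
        exact ⟨a + a', b + b', by
          rw [AddSubmonoid.coe_add, AddSubmonoid.coe_add, ← h, ← h']; abel⟩
      neg_mem' := by
        rintro m ⟨a, b, h⟩
        exact ⟨b, a, by rw [← h]; abel⟩ }
  choose α β hαβ using fun k : K => k.2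
  let ξ : P → ℂˣ := fun a => Units.mk0 (x a) (hx a)
  have hξ : ∀ a b, ξ (a + b) = ξ a * ξ b := fun a b => Units.ext (hadd a b)
  have hwd : ∀ (k : K) (a b : P), k.1 + b.1 = a.1 → ξ (α k) / ξ (β k) = ξ a / ξ b := by
    intro k a b h
    rw [div_eq_div_iff_mul_eq_mul, ← hξ, ← hξ]
    congr 1
    apply Subtype.ext
    rw [AddSubmonoid.coe_add, AddSubmonoid.coe_add, ← h, ← hαβ k]
    abel
  let g : K →+ Additive ℂˣ :=
    { toFun := fun k => Additive.ofMul (ξ (α k) / ξ (β k))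
      map_zero' := by
        have := hwd 0 0 0 (by simp)
        rw [this, div_self']
        rfl
      map_add' := by
        intro k l
        have := hwd (k + l) (α k + α l) (β k + β l) (by
          rw [AddSubgroup.coe_add, AddSubmonoid.coe_add, AddSubmonoid.coe_add, ← hαβ k, ← hαβ l]
          abel)
        rw [this, hξ, hξ, ← ofMul_mul, mul_div_mul_comm] }
  have : DivisibleBy (Additive ℂˣ) ℕ := divisibleByOfSMulRightSurj _ _ fun {n} hn z => by
    obtain ⟨w, hw⟩ := IsAlgClosed.exists_pow_nat_eq (z.toMul : ℂ) (Nat.pos_of_ne_zero hn)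
    have hw0 : w ≠ 0 := by
      rintro rfl
      rw [zero_pow hn] at hw
      exact z.toMul.ne_zero hw.symm
    exact ⟨Additive.ofMul (Units.mk0 w hw0), congrArg Additive.ofMul
      (Units.ext hw : Units.mk0 w hw0 ^ n = z.toMul)⟩
  have : DivisibleBy (Additive ℂˣ) ℤ := AddGroup.divisibleByIntOfDivisibleByNat _
  obtain ⟨h, hh⟩ := (Module.Baer.of_divisible (Additive ℂˣ)).extension_property_addMonoidHom
    K.subtype K.subtype_injective g
  refine ⟨AddMonoidHom.toMultiplicativeLeft h, fun a => ?_⟩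
  have hK : a.1 ∈ K := ⟨a, 0, by simp⟩
  have e := DFunLike.congr_fun hh ⟨a.1, hK⟩
  have e2 := hwd ⟨a.1, hK⟩ a 0 (by simp)
  have hξ0 : ξ 0 = 1 := by
    have := hξ 0 0
    rw [add_zero] at this
    exact left_eq_mul.mp this
  rw [hξ0, div_one] at e2
  exact congrArg Units.val ((congrArg Additive.toMul e).trans e2)

variable {N : Type*} [AddCommGroup N]

theorem AffineChart.isInducing_val {σ : PointedCone ℝ (RealSpace N)} :
    Topology.IsInducing fun x : AffineChart σ => x.1 := ⟨rfl⟩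

/-- The functionals in `S_σ` that do not vanish at a point of `U_σ`. -/
def AffineChart.support {σ : PointedCone ℝ (RealSpace N)} (x : AffineChart σ) :
    AddSubmonoid (Module.Dual ℤ N) where
  carrier := {m | ∃ h : m ∈ dualMonoid σ, x.1 ⟨m, h⟩ ≠ 0}
  zero_mem' := ⟨zero_mem _, by
    rw [show (⟨0, zero_mem _⟩ : dualMonoid σ) = 0 from rfl, x.2.1]; exact one_ne_zero⟩
  add_mem' := by
    rintro a b ⟨ha, ha'⟩ ⟨hb, hb'⟩
    exact ⟨add_mem ha hb, (x.2.2 ⟨a, ha⟩ ⟨b, hb⟩).symm ▸ mul_ne_zero ha' hb'⟩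

/-- The values of a point of `U_σ` extend, where nonzero, to a character of the torus. -/
theorem AffineChart.exists_character {σ : PointedCone ℝ (RealSpace N)} (x : AffineChart σ) :
    ∃ χ : Torus N, ∀ m : dualMonoid σ, x.1 m ≠ 0 →
      (χ (Multiplicative.ofAdd m.1) : ℂ) = x.1 m := by
  obtain ⟨χ, hχ⟩ := exists_character_extension x.support (fun m => x.1 ⟨m.1, m.2.1⟩)
    (fun m => m.2.2) (fun a b => x.2.2 ⟨a.1, a.2.1⟩ ⟨b.1, b.2.1⟩)
  exact ⟨χ, fun m hm => hχ ⟨m.1, m.2, hm⟩⟩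

theorem AffineChart.exists_torus_of_ne_zero {σ : PointedCone ℝ (RealSpace N)}
    (x : AffineChart σ) (hx : ∀ m, x.1 m ≠ 0) : ∃ t : Torus N, x = t.toChart σ := by
  obtain ⟨χ, hχ⟩ := x.exists_character
  exact ⟨χ, Subtype.ext (funext fun m => (hχ m (hx m)).symm)⟩

theorem mem_dualMonoid_bot (m : Module.Dual ℤ N) :
    m ∈ dualMonoid (⊥ : PointedCone ℝ (RealSpace N)) := by
  intro x hx
  rw [Submodule.mem_bot] at hx
  simp [hx]

/-- Every element of `S_{0} = M` has a negative, so each coordinate is invertible. -/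
theorem AffineChart.ne_zero_of_bot (x : AffineChart (⊥ : PointedCone ℝ (RealSpace N)))
    (m) : x.1 m ≠ 0 := by
  intro h
  have := x.2.2 m ⟨-m.1, mem_dualMonoid_bot _⟩
  rw [show m + ⟨-m.1, mem_dualMonoid_bot _⟩ = 0 from Subtype.ext (add_neg_cancel m.1), x.2.1, h,
    zero_mul] at this
  exact one_ne_zero this

theorem Torus.toChart_bot_injective :
    Function.Injective fun t : Torus N => t.toChart ⊥ := by
  intro t t' h
  refine MonoidHom.ext fun m => Units.ext ?_
  exact congrFun (congrArg Subtype.val h) ⟨m.toAdd, mem_dualMonoid_bot _⟩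

/-! ### The torus and the boundary divisors -/

namespace Fan

variable (F : Fan N)

theorem incl_restrict {τ σ : F.cones} (h : τ.1 ≤ σ.1) (y : AffineChart τ.1) :
    F.incl σ (y.restrict h) = F.incl τ y :=
  Quot.sound ⟨h, rfl⟩

theorem incl_toChart (σ : F.cones) (t : Torus N) : F.incl σ (t.toChart σ.1) = F.torusIncl t :=
  F.incl_restrict (τ := ⟨⊥, F.zero_mem⟩) bot_le (t.toChart ⊥)

theorem continuous_incl (σ : F.cones) : Continuous (F.incl σ) :=
  continuous_quot_mk.comp continuous_sigmaMk

/-- A point of a chart at which all the coordinates are nonzero is a point of the torus. -/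
theorem exists_torusIncl_of_ne_zero (σ : F.cones) (x : AffineChart σ.1) (hx : ∀ m, x.1 m ≠ 0) :
    ∃ t, F.incl σ x = F.torusIncl t := by
  obtain ⟨t, rfl⟩ := x.exists_torus_of_ne_zero hx
  exact ⟨t, F.incl_toChart σ t⟩

variable [Module.Free ℤ N] [Module.Finite ℤ N]

/-- For a face `τ` of `σ`, the point of the torus that gives a point of `U_τ` is determined by the
image in `U_σ`. -/
theorem restrict_eq_toChart_iff {τ σ : F.cones} (h : τ.1 ≤ σ.1) (y : AffineChart τ.1)
    (t : Torus N) : y.restrict h = t.toChart σ.1 ↔ y = t.toChart τ.1 := by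
  refine ⟨fun e => Subtype.ext (funext fun m => ?_), fun e => by rw [e]; rfl⟩
  obtain ⟨s, hσ⟩ := F.rational σ.1 σ.2
  -- Writing `m = (m + b) - b` with both terms in `S_σ` recovers the value at `m` from values on
  -- `U_σ`, as the value at `b` is nonzero.
  obtain ⟨b, hb, hmb⟩ := exists_sub_of_salient s.finite_toSet (hσ ▸ F.salient σ.1 σ.2) m.1
  rw [← hσ] at hb hmb
  have e1 := congrFun (congrArg Subtype.val e) ⟨b, hb⟩
  have e2 := congrFun (congrArg Subtype.val e) ⟨m.1 + b, hmb⟩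
  have e3 := y.2.2 m ⟨b, dualMonoid_anti h hb⟩
  have e4 := (t.toChart τ.1).2.2 m ⟨b, dualMonoid_anti h hb⟩
  change y.1 ⟨b, dualMonoid_anti h hb⟩ = (t (Multiplicative.ofAdd b) : ℂ) at e1
  change y.1 (m + ⟨b, dualMonoid_anti h hb⟩) =
    (t.toChart τ.1).1 (m + ⟨b, dualMonoid_anti h hb⟩) at e2
  rw [e2, e4, e1] at e3
  exact (mul_right_cancel₀ (Units.ne_zero _) e3).symm

/-- The torus is embedded in the toric variety. -/
theorem torusIncl_injective : Function.Injective F.torusIncl := by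
  -- `Glue` only generates the identification. The set of torus points representing a given point is
  -- an invariant of it, which avoids analysing chains of gluings.
  let Φ : F.Variety → Set (Torus N) := Quot.lift (fun p => {t | p.2 = t.toChart p.1.1}) (by
    rintro p q ⟨h, e⟩
    ext t
    change p.2 = _ ↔ q.2 = _
    rw [e]
    exact F.restrict_eq_toChart_iff h q.2 t)
  intro t t' e
  have h : t ∈ Φ (F.torusIncl t) := rfl
  rw [e] at h
  exact (Torus.toChart_bot_injective h).symm

/-- Every point outside the torus lies on a toric divisor. -/
theorem exists_mem_toricDivisor (σ : F.cones) (x : AffineChart σ.1) {m₁ : dualMonoid σ.1}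
    (hm₁ : x.1 m₁ = 0) : ∃ ρ : F.Ray, F.incl σ x ∈ F.toricDivisor ρ := by
  classical
  obtain ⟨s, hs, hσ, hray⟩ := F.exists_ray_generators σ.2
  have hmem : ∀ m : Module.Dual ℤ N, m ∈ dualMonoid σ.1 ↔ ∀ v ∈ s, 0 ≤ m v := fun m => by
    rw [hσ, mem_dualMonoid_latticeCone]
  -- `A` generates the face of `σ` whose orbit contains the point, and `n` is a vector in the
  -- relative interior of that face.
  let A : Finset N := hs.toFinset.filter fun v => ∀ m ∈ x.support, m v = 0
  let n : N := ∑ v ∈ A, v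
  have hA : ∀ v, v ∈ A ↔ v ∈ s ∧ ∀ m ∈ x.support, m v = 0 := fun v => by simp [A]
  have hn : ∀ m : Module.Dual ℤ N, m n = ∑ v ∈ A, m v := fun m => map_sum m _ _
  -- a functional in the support which is positive on all other generators
  obtain ⟨p, hp, hpos⟩ : ∃ p ∈ x.support, ∀ v ∈ s, v ∉ A → 0 < p v := by
    have : ∀ v ∈ s, v ∉ A → ∃ m ∈ x.support, 0 < m v := by
      intro v hv hvA
      rw [hA] at hvA
      push Not at hvA
      obtain ⟨m, hm, h0⟩ := hvA hv
      exact ⟨m, hm, lt_of_le_of_ne ((hmem m).mp hm.1 v hv) h0.symm⟩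
    choose! q hq hq0 using this
    refine ⟨∑ v ∈ hs.toFinset \ A, q v, sum_mem fun v hv => ?_, fun v hv hvA => ?_⟩
    · simp only [Finset.mem_sdiff, Set.Finite.mem_toFinset] at hv
      exact hq v hv.1 hv.2
    · rw [LinearMap.sum_apply]
      refine Finset.sum_pos' (fun w hw => ?_) ⟨v, by simp [hv, hvA], hq0 v hv hvA⟩
      simp only [Finset.mem_sdiff, Set.Finite.mem_toFinset] at hw
      exact (hmem _).mp (hq w hw.1 hw.2).1 v hv
  have hnn : ∀ m : dualMonoid σ.1, 0 ≤ m.1 n := fun m => by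
    rw [hn]
    exact Finset.sum_nonneg fun v hv => (hmem _).mp m.2 v ((hA v).mp hv).1
  have hzero : ∀ m : dualMonoid σ.1, m.1 n = 0 → ∀ v ∈ A, m.1 v = 0 := fun m h => by
    rw [hn] at h
    exact (Finset.sum_eq_zero_iff_of_nonneg fun v hv =>
      (hmem _).mp m.2 v ((hA v).mp hv).1).mp h
  have hsupp : ∀ m : dualMonoid σ.1, x.1 m ≠ 0 ↔ m.1 n = 0 := by
    intro m
    constructor
    · intro h
      rw [hn]
      exact Finset.sum_eq_zero fun v hv => ((hA v).mp hv).2 m.1 ⟨m.2, h⟩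
    · intro h h0
      obtain ⟨k, hk⟩ : ∃ k : ℕ, ∀ v ∈ s, m.1 v ≤ k := by
        obtain ⟨K, hK⟩ := (hs.image fun v => m.1 v).bddAbove
        exact ⟨K.toNat, fun v hv => (hK ⟨v, hv, rfl⟩).trans (Int.self_le_toNat K)⟩
      -- If `χ^m` vanished at `x`, so would its multiple `χ^(k • p)`, although `p` is in the
      -- support.
      have hd : k • p - m.1 ∈ dualMonoid σ.1 := by
        refine (hmem _).mpr fun v hv => ?_
        simp only [LinearMap.sub_apply, LinearMap.smul_apply, nsmul_eq_mul]
        by_cases hvA : v ∈ A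
        · rw [hzero m h v hvA, ((hA v).mp hvA).2 p hp]
          simp
        · have h1 := hpos v hv hvA
          have h2 := hk v hv
          nlinarith
      obtain ⟨hkp, hkp0⟩ := x.support.nsmul_mem hp k
      have := x.2.2 m ⟨_, hd⟩
      rw [h0, zero_mul] at this
      have e : (⟨k • p, hkp⟩ : dualMonoid σ.1) = m + ⟨_, hd⟩ :=
        Subtype.ext (add_sub_cancel m.1 (k • p)).symm
      exact hkp0 (by rw [e, ← this])
  -- Some coordinate vanishes at `x`, so `n ≠ 0` and the face has a ray `v`.
  obtain ⟨v, hv⟩ : A.Nonempty := by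
    by_contra hne
    rw [Finset.not_nonempty_iff_eq_empty] at hne
    exact (hsupp m₁).mpr (by rw [hn, hne, Finset.sum_empty]) hm₁
  have hvs := ((hA v).mp hv).1
  let ρ : F.Ray := ⟨v, hray v hvs⟩
  have hρσ : ρ.cone.1 ≤ σ.1 := by
    rw [hσ]
    exact latticeCone_mono (Set.singleton_subset_iff.mpr hvs)
  have hρ : ∀ m : dualMonoid ρ.cone.1, 0 ≤ m.1 v := fun m =>
    mem_dualMonoid_latticeCone.mp m.2 v rfl
  obtain ⟨χ, hχ⟩ := x.exists_character
  let c : ℕ → ℂ := fun j => ((j : ℂ) + 1)⁻¹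
  have hc0 : ∀ j, c j ≠ 0 := fun j => inv_ne_zero (Nat.cast_add_one_ne_zero j)
  -- The point of `O(ρ)` with character `χ`, moved by the one-parameter subgroup of `n` at the
  -- parameter `c j → 0`. The exponent `m n` may be negative on `S_ρ`, hence `c j ≠ 0`; on `S_σ` it
  -- is nonnegative, so the limit exists in `U_σ` and is `x`.
  let y : ℕ → AffineChart ρ.cone.1 := fun j =>
    ⟨fun m => if m.1 v = 0 then (χ (Multiplicative.ofAdd m.1) : ℂ) * c j ^ (m.1 n) else 0,
      by simp, fun a b => by
        have ha := hρ a
        have hb := hρ b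
        have hab : (a + b).1 v = 0 ↔ a.1 v = 0 ∧ b.1 v = 0 := by
          rw [AddSubmonoid.coe_add, LinearMap.add_apply]
          omega
        simp only [hab]
        by_cases h1 : a.1 v = 0 <;> by_cases h2 : b.1 v = 0 <;> simp [h1, h2]
        rw [zpow_add₀ (hc0 j)]
        ring⟩
  refine ⟨ρ, mem_closure_of_tendsto (f := fun j => F.incl ρ.cone (y j)) (b := Filter.atTop) ?_
    (Filter.Eventually.of_forall fun j => ⟨y j, fun m => ?_, rfl⟩)⟩
  · simp only [← F.incl_restrict hρσ]
    refine ((F.continuous_incl σ).tendsto x).comp ?_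
    rw [AffineChart.isInducing_val.tendsto_nhds_iff, tendsto_pi_nhds]
    intro m
    change Filter.Tendsto (fun j => if m.1 v = 0 then
      (χ (Multiplicative.ofAdd m.1) : ℂ) * c j ^ (m.1 n) else 0) Filter.atTop (𝓝 (x.1 m))
    rcases (hnn m).eq_or_lt with h0 | h0
    · have hx := (hsupp m).mpr h0.symm
      simp [hzero m h0.symm v hv, ← h0, hχ m hx]
    · have hx : x.1 m = 0 := by
        by_contra hx
        exact h0.ne' ((hsupp m).mp hx)
      rw [hx]
      split_ifs
      · obtain ⟨k, hk⟩ := Int.eq_ofNat_of_zero_le h0.le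
        have hk0 : k ≠ 0 := by rintro rfl; simp [hk] at h0
        rw [hk]
        simp only [zpow_natCast]
        have hc : Filter.Tendsto c Filter.atTop (𝓝 0) := by
          simpa [c, one_div] using tendsto_one_div_add_atTop_nhds_zero_nat (𝕜 := ℂ)
        simpa [hk0] using (hc.pow k).const_mul (χ (Multiplicative.ofAdd m.1) : ℂ)
      · exact tendsto_const_nhds
  · change (if m.1 v = 0 then _ else (0 : ℂ)) ≠ 0 ↔ ∀ z ∈ latticeCone {v}, _
    rw [pairing_eq_zero_on_ray]
    split_ifs with h
    · simp [h, hc0 j, zpow_ne_zero]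
    · simp [h]

/-- A point of the toric variety lies in the torus or on a toric divisor. -/
theorem mem_torus_or_mem_toricDivisor (p : F.Variety) :
    (∃ t, p = F.torusIncl t) ∨ ∃ ρ : F.Ray, p ∈ F.toricDivisor ρ := by
  obtain ⟨⟨σ, x⟩, rfl⟩ := Quot.exists_rep p
  by_cases hx : ∀ m, x.1 m ≠ 0
  · exact Or.inl (F.exists_torusIncl_of_ne_zero σ x hx)
  · push Not at hx
    obtain ⟨m, hm⟩ := hx
    exact Or.inr (F.exists_mem_toricDivisor σ x hm)

end Fan

/-! ### Holomorphic functions on the Riemann sphere -/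

/-- A holomorphic function on the Riemann sphere is constant. -/
theorem eq_of_sphereHolomorphicAt {h : OnePoint ℂ → ℂ} (hh : ∀ p, SphereHolomorphicAt h p)
    (p : OnePoint ℂ) : h p = h OnePoint.infty := by
  induction p using OnePoint.rec with
  | infty => rfl
  | coe z =>
    have hd : Differentiable ℂ fun z : ℂ => h (z : OnePoint ℂ) := fun z =>
      ((hh z).1 z rfl).differentiableAt
    -- Liouville: an entire function with a limit at infinity equals that limit. Continuity in the
    -- coordinate `w = 1 / z` supplies the limit.
    refine hd.apply_eq_of_tendsto_cocompact z ?_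
    have h1 := ((hh OnePoint.infty).2 rfl).continuousAt.tendsto
    have h2 : Filter.Tendsto (fun z : ℂ => z⁻¹) (Filter.cocompact ℂ) (𝓝 0) :=
      Filter.tendsto_inv₀_cobounded.mono_left Metric.cobounded_eq_cocompact.ge
    rw [show sphereChartInfty 0 = OnePoint.infty by simp [sphereChartInfty]] at h1
    refine (h1.comp h2).congr' ?_
    filter_upwards [(isCompact_singleton (x := (0 : ℂ))).compl_mem_cocompact] with w hw
    have hw0 : w ≠ 0 := hw
    simp [sphereChartInfty, hw0]

/-! ### Holomorphic spheres in toric varieties -/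

namespace Fan

variable {N : Type*} [AddCommGroup N] (F : Fan N)

/-- A function given by a coordinate `χ^m` in a chart is holomorphic on the chart. -/
theorem isHolomorphicAt_of_eq_coordinate {f : F.Variety → ℂ} (σ : F.cones) (m : dualMonoid σ.1)
    (hf : ∀ y, f (F.incl σ y) = y.1 m) (x : AffineChart σ.1) :
    F.IsHolomorphicAt f (F.incl σ x) :=
  ⟨σ, x, 1, fun _ => m, fun w => w 0, rfl,
    (ContinuousLinearMap.proj (R := ℂ) (φ := fun _ : Fin 1 => ℂ) 0).analyticAt _,
    Filter.Eventually.of_forall hf⟩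

variable [Module.Free ℤ N] [Module.Finite ℤ N]

/-- The character `χ^m`, extended by zero to the toric variety. -/
def characterExtension (m : Module.Dual ℤ N) : F.Variety → ℂ :=
  -- Germs are tested on globally defined functions; the value off the torus plays no role.
  Function.extend F.torusIncl (fun t => (t (Multiplicative.ofAdd m) : ℂ)) 0

theorem characterExtension_torusIncl (m : Module.Dual ℤ N) (t : Torus N) :
    F.characterExtension m (F.torusIncl t) = t (Multiplicative.ofAdd m) :=
  F.torusIncl_injective.extend_apply _ _ t

theorem isHolomorphicAt_characterExtension (m : Module.Dual ℤ N) (t : Torus N) :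
    F.IsHolomorphicAt (F.characterExtension m) (F.torusIncl t) := by
  refine F.isHolomorphicAt_of_eq_coordinate ⟨⊥, F.zero_mem⟩ ⟨m, mem_dualMonoid_bot m⟩
    (fun y => ?_) _
  obtain ⟨t, rfl⟩ := y.exists_torus_of_ne_zero y.ne_zero_of_bot
  exact F.characterExtension_torusIncl m t

/-- A holomorphic sphere in the torus is constant. -/
theorem IsHolomorphicSphere.eq_of_forall_mem_torus {u : OnePoint ℂ → F.Variety}
    (hu : F.IsHolomorphicSphere u) (ht : ∀ p, ∃ t, u p = F.torusIncl t) (p : OnePoint ℂ) :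
    u p = u OnePoint.infty := by
  choose t ht using ht
  rw [ht, ht]
  congr 1
  refine MonoidHom.ext fun m => Units.ext ?_
  -- Each character pulls back to a holomorphic function on the sphere, hence to a constant.
  have := eq_of_sphereHolomorphicAt (h := F.characterExtension m.toAdd ∘ u)
    (fun q => hu.2 q _ (by rw [ht]; exact F.isHolomorphicAt_characterExtension _ _)) p
  simpa only [Function.comp_apply, ht, characterExtension_torusIncl, ofAdd_toAdd] using this

/-- The constant value of `f ∘ u` is nonzero if `u` meets the torus and zero if it meets a divisor,
so a sphere cannot meet both. -/
theorem spheresLieInDivisors_of_definesVanishingFunction {ν : Module.Dual ℤ N}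
    (hν : F.DefinesVanishingFunction ν) : F.SpheresLieInDivisors := by
  obtain ⟨f, hf, hft, hfD⟩ := hν
  rintro u hu hnc _ ⟨p, rfl⟩
  have hconst := eq_of_sphereHolomorphicAt (h := f ∘ u) fun q => hu.2 q f (hf _)
  rcases F.mem_torus_or_mem_toricDivisor (u p) with ⟨t, ht⟩ | ⟨ρ, hρ⟩
  · refine (hnc ⟨u OnePoint.infty, fun q => hu.eq_of_forall_mem_torus F (fun r => ?_) q⟩).elim
    refine (F.mem_torus_or_mem_toricDivisor (u r)).resolve_right ?_
    rintro ⟨ρ, hρ⟩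
    have h1 : f (u p) = f (u r) := (hconst p).trans (hconst r).symm
    rw [ht, hft, hfD ρ _ hρ] at h1
    exact Units.ne_zero _ h1
  · exact Set.mem_iUnion.mpr ⟨ρ, hρ⟩

/-- A functional which is `1` on all primitive ray generators defines a holomorphic function that
vanishes on all toric divisors. -/
theorem definesVanishingFunction_of_gen_eq_one {ν : Module.Dual ℤ N}
    (hν : ∀ ρ : F.Ray, ν ρ.gen = 1) : F.DefinesVanishingFunction ν := by
  have hmem : ∀ σ : F.cones, ν ∈ dualMonoid σ.1 := by
    intro σ
    obtain ⟨s, -, hσ, hray⟩ := F.exists_ray_generators σ.2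
    rw [hσ, mem_dualMonoid_latticeCone]
    exact fun v hv => (hν ⟨v, hray v hv⟩).symm ▸ zero_le_one
  -- The coordinates `χ^ν` of the charts agree under gluing, since restriction preserves values.
  let f : F.Variety → ℂ := Quot.lift (fun p => p.2.1 ⟨ν, hmem p.1⟩) (by
    rintro p q ⟨h, e⟩
    rw [e]
    rfl)
  have hf : ∀ (σ : F.cones) (y : AffineChart σ.1), f (F.incl σ y) = y.1 ⟨ν, hmem σ⟩ :=
    fun _ _ => rfl
  have hcont : Continuous f := by
    refine continuous_quot_lift _ (continuous_sigma fun σ => ?_)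
    exact (continuous_apply (⟨ν, hmem σ⟩ : dualMonoid σ.1)).comp continuous_subtype_val
  refine ⟨f, fun p => ?_, fun t => rfl, fun ρ => ?_⟩
  · obtain ⟨⟨σ, x⟩, rfl⟩ := Quot.exists_rep p
    exact F.isHolomorphicAt_of_eq_coordinate σ ⟨ν, hmem σ⟩ (hf σ) x
  · refine closure_minimal (t := f ⁻¹' {0}) ?_ (isClosed_singleton.preimage hcont)
    rintro _ ⟨x, hx, rfl⟩
    by_contra h0
    -- On `O(ρ)` a nonzero value of `χ^ν` would put `ν` in `ρ^⊥`.
    have h1 : ν ρ.gen = 0 := pairing_eq_zero_on_ray.mp ((hx ⟨ν, hmem _⟩).mp h0)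
    exact one_ne_zero ((hν ρ).symm.trans h1)

end Fan

end ToricGeometry

end

theorem mainTheorem10 (N : Type*) [AddCommGroup N] [Module.Free ℤ N] [Module.Finite ℤ N]
    (F : ToricGeometry.Fan N) :
    (∀ ν : Module.Dual ℤ N, F.DefinesVanishingFunction ν → F.SpheresLieInDivisors) ∧
      (F.IsCalabiYau →
        (∃ ν : Module.Dual ℤ N, F.DefinesVanishingFunction ν) ∧ F.SpheresLieInDivisors) := by
  refine ⟨fun ν hν => F.spheresLieInDivisors_of_definesVanishingFunction hν, ?_⟩
  rintro ⟨ν, hν⟩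
  have h := F.definesVanishingFunction_of_gen_eq_one hν
  exact ⟨⟨ν, h⟩, F.spheresLieInDivisors_of_definesVanishingFunction h⟩
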